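/- Let $G$ be a finite group with centre $Z(G)$, let $z=|Z(G)|$, and suppose that $G/Z(G)\cong D_{2n}$, the dihedral group of order $2n$, for some integer $n\ge 3$. Let $\Gamma_G$ be the commuting conjugacy class graph of $G$: its vertices are the conjugacy classes $x^G$ of the elements $x\in G\setminus Z(G)$, and two distinct vertices $x^G$, $y^G$ are adjacent if and only if some $x'\in x^G$ and $y'\in y^G$ commute. For a finite simple graph $\mathcal G$ with vertex set $V=\{v_1,\dots,v_m\}$, let $CN(\mathcal G)$ be the $m\times m$ matrix whose $(i,j)$ entry is the number of common neighbours of $v_i$ and $v_j$ if $i\ne j$, and $0$ if $i=j$; let $CNRS(\mathcal G)$ be the diagonal matrix whose $i$-th diagonal entry is the $i$-th row sum of $CN(\mathcal G)$; and let $\Delta(\mathcal G)=\operatorname{tr}(CNRS(\mathcal G))/|V|$. Put $$E_{CN}(\mathcal G)=\sum_{\lambda}|\lambda|,\qquad LE_{CN}(\mathcal G)=\sum_{\alpha}|\alpha-\Delta(\mathcal G)|,\qquad LE^+_{CN}(\mathcal G)=\sum_{\beta}|\beta-\Delta(\mathcal G)|,$$ where $\lambda$, $\alpha$, $\beta$ run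 over the eigenvalues, counted with multiplicity, of $CN(\mathcal G)$, of $CNRS(\mathcal G)-CN(\mathcal G)$ and of $CNRS(\mathcal G)+CN(\mathcal G)$, respectively. If $n=3$ and $z\ge 1$, or $n=5$ and $z=1$, then $$E_{CN}(\Gamma_G)=LE_{CN}(\Gamma_G)=LE^+_{CN}(\Gamma_G).$$ In all other cases, $$E_{CN}(\Gamma_G)<LE^+_{CN}(\Gamma_G)<LE_{CN}(\Gamma_G).$$ -/

import Mathlib

/-- The vertices of the commuting conjugacy class graph of `G`: the conjugacy classes `x^G`
of the elements `x ∈ G ∖ Z(G)`. -/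
abbrev CCCVertex (G : Type*) [Group G] : Type _ :=
  {c : ConjClasses G // ∃ x : G, x ∉ Subgroup.center G ∧ ConjClasses.mk x = c}

noncomputable instance CCCVertex.instFintype (G : Type*) [Group G] [Finite G] :
    Fintype (CCCVertex G) :=
  Fintype.ofFinite _

/-- The commuting conjugacy class graph of `G`: two distinct noncentral classes `x^G`, `y^G` are
adjacent if some `x' ∈ x^G` and `y' ∈ y^G` commute. -/
def cccGraph (G : Type*) [Group G] : SimpleGraph (CCCVertex G) where
  Adj a b := a ≠ b ∧ ∃ x ∈ a.1.carrier, ∃ y ∈ b.1.carrier, Commute x y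
  symm := ⟨fun _ _ h => ⟨h.1.symm, by
    obtain ⟨-, x, hx, y, hy, hxy⟩ := h
    exact ⟨y, hy, x, hx, hxy.symm⟩⟩⟩
  loopless := ⟨fun _ h => h.1 rfl⟩

noncomputable section

namespace SimpleGraph

variable {V : Type*}

open Classical in
/-- The common neighborhood matrix: for `i ≠ j` the entry is the number of vertices adjacent to
both `i` and `j` (such a vertex is automatically different from `i` and `j`), and the diagonal
is zero. -/
def cnMatrix (Γ : SimpleGraph V) : Matrix V V ℝ :=
  Matrix.of fun i j => if i ≠ j then ((Γ.commonNeighbors i j).ncard : ℝ) else 0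

theorem isHermitian_cnMatrix (Γ : SimpleGraph V) : Γ.cnMatrix.IsHermitian := by
  refine Matrix.IsHermitian.ext fun i j => ?_
  by_cases h : i = j
  · simp [cnMatrix, h]
  · simp [cnMatrix, h, Ne.symm h, Γ.commonNeighbors_symm j i]

variable [Fintype V]

open Classical in
/-- The diagonal matrix of the row sums of the common neighborhood matrix. -/
def cnRowSumMatrix (Γ : SimpleGraph V) : Matrix V V ℝ :=
  Matrix.diagonal fun i => ∑ k, Γ.cnMatrix i k

/-- The common neighborhood Laplacian matrix. -/
def cnLaplacian (Γ : SimpleGraph V) : Matrix V V ℝ :=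
  Γ.cnRowSumMatrix - Γ.cnMatrix

/-- The common neighborhood signless Laplacian matrix. -/
def cnSignlessLaplacian (Γ : SimpleGraph V) : Matrix V V ℝ :=
  Γ.cnRowSumMatrix + Γ.cnMatrix

open Classical in
/-- The multiset of the eigenvalues of a square real matrix, with (algebraic) multiplicities.
It is applied only to the symmetric matrices above (see the lemmas below), all of whose
eigenvalues are real and for which algebraic and geometric multiplicities agree. -/
def eigenvalueMultiset (M : Matrix V V ℝ) : Multiset ℝ := M.charpoly.roots

/-- The average `tr(CNRS) / |V|` of the row sums of the common neighborhood matrix. -/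
def cnDelta (Γ : SimpleGraph V) : ℝ :=
  Γ.cnRowSumMatrix.trace / (Fintype.card V : ℝ)

/-- The common neighborhood energy. -/
def cnEnergy (Γ : SimpleGraph V) : ℝ :=
  ((eigenvalueMultiset Γ.cnMatrix).map fun x => |x|).sum

/-- The common neighborhood Laplacian energy. -/
def cnLaplacianEnergy (Γ : SimpleGraph V) : ℝ :=
  ((eigenvalueMultiset Γ.cnLaplacian).map fun x => |x - Γ.cnDelta|).sum

/-- The common neighborhood signless Laplacian energy. -/
def cnSignlessLaplacianEnergy (Γ : SimpleGraph V) : ℝ :=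
  ((eigenvalueMultiset Γ.cnSignlessLaplacian).map fun x => |x - Γ.cnDelta|).sum

theorem isHermitian_cnRowSumMatrix (Γ : SimpleGraph V) : Γ.cnRowSumMatrix.IsHermitian := by
  classical
  unfold cnRowSumMatrix
  convert Matrix.isHermitian_diagonal (fun i => ∑ k, Γ.cnMatrix i k)

theorem isHermitian_cnLaplacian (Γ : SimpleGraph V) : Γ.cnLaplacian.IsHermitian :=
  Γ.isHermitian_cnRowSumMatrix.sub Γ.isHermitian_cnMatrix

theorem isHermitian_cnSignlessLaplacian (Γ : SimpleGraph V) :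
    Γ.cnSignlessLaplacian.IsHermitian :=
  Γ.isHermitian_cnRowSumMatrix.add Γ.isHermitian_cnMatrix

end SimpleGraph

end

/-!
Two noncentral elements of `G` lying over a rotation commute, since the rotations form a cyclic
quotient of their preimage by central elements; an element over a reflection commutes only with
elements lying over the same reflection or over `1`. Hence two noncentral classes are adjacent
exactly when both lie over rotations or both lie over one conjugacy class of reflections, and
`cccGraph G` is a disjoint union of cliques. There are `k = gcd(n, 2)` classes of reflections, each
of which gives a clique on `b = z / k` vertices, and the rotations give a clique on `m b` vertices,
where `m = k (n - 1) / 2`.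

On a clique with `s` vertices the row sums of the common neighborhood matrix are
`A = (s - 1) (s - 2)`, and each of the three matrices has one simple eigenvalue and one of
multiplicity `s - 1`. The average `Δ` of the row sums is a weighted mean of the values of `A`. If
these are all equal, so are the energies. Otherwise the rotation clique dominates: its value exceeds
`Δ` while the others are at most `Δ / 2`. Every eigenvalue on the small cliques is then at most `Δ`,
so their contribution to either Laplacian energy is `∑ s (Δ - A)`, which equals `s (A - Δ)` for the
dominant clique, and both inequalities reduce to inequalities about the dominant clique alone.
-/

section BlockMatrix

open Polynomial SimpleGraph

theorem charpoly_scalar_add_vecMulVec {V R : Type*} [Fintype V] [DecidableEq V] [Nonempty V]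
    [CommRing R] (a : R) (u v : V → R) :
    (Matrix.scalar V a + Matrix.vecMulVec u v).charpoly =
      (X - C a) ^ (Fintype.card V - 1) * (X - C (a + u ⬝ᵥ v)) := by
  nontriviality R
  have shift := Matrix.charpoly_sub_scalar (Matrix.vecMulVec u v) (-a)
  rw [map_neg, sub_neg_eq_add, add_comm] at shift
  rw [shift, Matrix.charpoly_vecMulVec]
  obtain ⟨k, hk⟩ := Nat.exists_eq_succ_of_ne_zero (Fintype.card_ne_zero (α := V))
  simp only [hk, Nat.succ_sub_one, sub_comp, pow_comp, X_comp, smul_eq_C_mul, mul_comp, C_comp,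
    map_neg, map_add, pow_succ]
  ring

variable {V ι R : Type*}

open Classical in
/-- The matrix which, after sorting the indices by the value of `f`, is block diagonal with blocks
`α i • I + β i • J`, where `J` is the all-ones matrix on the fibre of `f` over `i`. -/
noncomputable def cliqueBlockMatrix [Semiring R] (f : V → ι) (α β : ι → R) : Matrix V V R :=
  Matrix.diagonal (α ∘ f) + Matrix.of fun u v => if f u = f v then β (f u) else 0

theorem charpoly_cliqueBlockMatrix [Fintype V] [DecidableEq V] [DecidableEq ι] [CommRing R]
    (f : V → ι) (α β : ι → R) :
    (cliqueBlockMatrix f α β).charpoly =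
      ∏ i ∈ Finset.univ.image f, (X - C (α i)) ^ ((f ⁻¹' {i}).ncard - 1) *
        (X - C (α i + (f ⁻¹' {i}).ncard * β i)) := by
  classical
  have order : LinearOrder ι := linearOrderOfSTO WellOrderingRel
  cases Subsingleton.elim ‹DecidableEq ι› order.toDecidableEq
  have triangular : (cliqueBlockMatrix f α β).BlockTriangular f := fun u v h => by
    have hne : f u ≠ f v := h.ne'
    simp [cliqueBlockMatrix, hne, ne_of_apply_ne f hne]
  rw [triangular.charpoly]
  refine Finset.prod_congr rfl fun i hi => ?_
  obtain ⟨v, -, hv⟩ := Finset.mem_image.1 hi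
  have : Nonempty {u // f u = i} := ⟨⟨v, hv⟩⟩
  have block : (cliqueBlockMatrix f α β).toSquareBlock f i =
      Matrix.scalar _ (α i) + Matrix.vecMulVec 1 fun _ => β i := by
    ext ⟨u, rfl⟩ ⟨w, hw⟩
    by_cases h : u = w <;> simp [cliqueBlockMatrix, Matrix.toSquareBlock_def, hw, h]
  have card : Fintype.card {u // f u = i} = (f ⁻¹' {i}).ncard :=
    Nat.card_eq_fintype_card.symm
  rw [block, charpoly_scalar_add_vecMulVec, card]
  simp [dotProduct, card]

theorem eigenvalueMultiset_cliqueBlockMatrix [Fintype V] [DecidableEq ι] (f : V → ι)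
    (α β : ι → ℝ) :
    eigenvalueMultiset (cliqueBlockMatrix f α β) =
      ∑ i ∈ Finset.univ.image f, (((f ⁻¹' {i}).ncard - 1) • {α i} +
        {α i + (f ⁻¹' {i}).ncard * β i}) := by
  have monic : ∀ i, ((X - C (α i)) ^ ((f ⁻¹' {i}).ncard - 1) *
      (X - C (α i + (f ⁻¹' {i}).ncard * β i))).Monic := fun i =>
    ((monic_X_sub_C _).pow _).mul (monic_X_sub_C _)
  classical
  rw [eigenvalueMultiset, charpoly_cliqueBlockMatrix,
    roots_prod _ _ (monic_prod_of_monic _ _ fun i _ => monic i).ne_zero, Multiset.bind,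
    Multiset.join]
  refine Finset.sum_congr rfl fun i _ => ?_
  rw [roots_mul (monic i).ne_zero, roots_pow, roots_X_sub_C, roots_X_sub_C]

theorem sum_map_eigenvalueMultiset_cliqueBlockMatrix [Fintype V] [Fintype ι] (f : V → ι)
    (α β : ι → ℝ) (g : ℝ → ℝ) :
    ((eigenvalueMultiset (cliqueBlockMatrix f α β)).map g).sum =
      ∑ i, (((f ⁻¹' {i}).ncard - 1) * g (α i) + g (α i + (f ⁻¹' {i}).ncard * β i)) := by
  classical
  calc ((eigenvalueMultiset (cliqueBlockMatrix f α β)).map g).sum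
      = ∑ i ∈ Finset.univ.image f, ((((f ⁻¹' {i}).ncard - 1 : ℕ) : ℝ) * g (α i) +
          g (α i + (f ⁻¹' {i}).ncard * β i)) := by
        rw [eigenvalueMultiset_cliqueBlockMatrix, ← Multiset.coe_mapAddMonoidHom,
          ← Multiset.coe_sumAddMonoidHom, map_sum, map_sum]
        simp [Multiset.map_nsmul, Multiset.sum_nsmul]
    _ = ∑ i ∈ Finset.univ.image f, (((f ⁻¹' {i}).ncard - 1) * g (α i) +
          g (α i + (f ⁻¹' {i}).ncard * β i)) := by
        refine Finset.sum_congr rfl fun i hi => ?_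
        obtain ⟨v, -, hv⟩ := Finset.mem_image.1 hi
        have nonempty_fiber : (f ⁻¹' {i}).Nonempty := ⟨v, hv⟩
        rw [Nat.cast_pred nonempty_fiber.ncard_pos]
    _ = _ := by
        refine Finset.sum_subset (Finset.subset_univ _) fun i _ hi => ?_
        have empty_fiber : f ⁻¹' {i} = ∅ :=
          Set.eq_empty_of_forall_notMem fun v hv => hi (Finset.mem_image.2 ⟨v, by simp, hv⟩)
        simp [empty_fiber]

end BlockMatrix

/-- The row sum `(s - 1) (s - 2)` of the common neighborhood matrix of a clique on `s` vertices; the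
formula has the value `2` at the meaningless `s = 0`. -/
noncomputable def cliqueRowSum (s : ℕ) : ℝ := (s - 1) * (s - 2)

theorem cliqueRowSum_nonneg (s : ℕ) : 0 ≤ cliqueRowSum s := by
  rw [cliqueRowSum]
  match s with
  | 0 | 1 => norm_num
  | s + 2 => push_cast; ring_nf; positivity

/-- `Γ` is a disjoint union of cliques indexed by `ι`, the clique with index `i` having `s i`
vertices; `f` sends a vertex to the index of its clique. -/
structure IsCliqueUnion {V ι : Type*} (Γ : SimpleGraph V) (s : ι → ℕ) (f : V → ι) : Prop where
  adj_iff (u v : V) : Γ.Adj u v ↔ u ≠ v ∧ f u = f v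
  ncard_fiber (i : ι) : (f ⁻¹' {i}).ncard = s i

namespace IsCliqueUnion

open SimpleGraph

variable {V ι : Type*} {Γ : SimpleGraph V} {s : ι → ℕ} {f : V → ι}

theorem ncard_commonNeighbors (h : IsCliqueUnion Γ s f) [Finite V] {u v : V} (huv : u ≠ v)
    (hf : f u = f v) : ((Γ.commonNeighbors u v).ncard : ℝ) = s (f u) - 2 := by
  have eq_sdiff : Γ.commonNeighbors u v = f ⁻¹' {f u} \ {u, v} := by
    ext w
    simp only [mem_commonNeighbors, h.adj_iff, Set.mem_sdiff, Set.mem_preimage,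
      Set.mem_singleton_iff, Set.mem_insert_iff]
    grind
  have pair_subset : {u, v} ⊆ f ⁻¹' {f u} := by
    rintro w (rfl | rfl) <;> simp [hf]
  have two_le : 2 ≤ s (f u) := by
    rw [← h.ncard_fiber, ← Set.ncard_pair huv]
    exact Set.ncard_le_ncard pair_subset
  rw [eq_sdiff, Set.ncard_sdiff pair_subset, Set.ncard_pair huv, h.ncard_fiber,
    Nat.cast_sub two_le, Nat.cast_ofNat]

theorem commonNeighbors_eq_empty (h : IsCliqueUnion Γ s f) {u v : V} (hf : f u ≠ f v) :
    Γ.commonNeighbors u v = ∅ := by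
  refine Set.eq_empty_of_forall_notMem fun w hw => ?_
  rw [mem_commonNeighbors, h.adj_iff, h.adj_iff] at hw
  exact hf (hw.1.2.trans hw.2.2.symm)

theorem cnMatrix_eq (h : IsCliqueUnion Γ s f) [Finite V] :
    Γ.cnMatrix = cliqueBlockMatrix f (fun i => 2 - s i : ι → ℝ) (fun i => s i - 2) := by
  ext u v
  by_cases huv : u = v
  · simp [cnMatrix, cliqueBlockMatrix, huv]
  by_cases hf : f u = f v
  · simp [cnMatrix, cliqueBlockMatrix, huv, hf, h.ncard_commonNeighbors huv hf]
  · simp [cnMatrix, cliqueBlockMatrix, huv, hf, h.commonNeighbors_eq_empty hf]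

variable [Fintype V]

theorem sum_cnMatrix_apply (h : IsCliqueUnion Γ s f) (u : V) :
    ∑ v, Γ.cnMatrix u v = cliqueRowSum (s (f u)) := by
  classical
  have card : (Finset.univ.filter fun v => f u = f v).card = s (f u) := by
    rw [← h.ncard_fiber, Set.ncard_eq_toFinset_card']
    congr 1
    ext v
    simp [eq_comm]
  simp only [h.cnMatrix_eq, cliqueBlockMatrix, Matrix.add_apply, Matrix.of_apply,
    Finset.sum_add_distrib, Matrix.diagonal_apply, Finset.sum_ite_eq, Finset.mem_univ, if_true,
    Function.comp_apply, ← Finset.sum_filter, Finset.sum_const, nsmul_eq_mul, card, cliqueRowSum]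
  ring

theorem cnRowSumMatrix_eq (h : IsCliqueUnion Γ s f) :
    Γ.cnRowSumMatrix =
      cliqueBlockMatrix f (fun i => cliqueRowSum (s i)) (fun _ => 0) := by
  ext u v
  simp only [cnRowSumMatrix, h.sum_cnMatrix_apply]
  simp [cliqueBlockMatrix, Function.comp_def]

theorem cnLaplacian_eq (h : IsCliqueUnion Γ s f) :
    Γ.cnLaplacian =
      cliqueBlockMatrix f (fun i => s i * (s i - 2) : ι → ℝ) (fun i => 2 - s i) := by
  rw [cnLaplacian, h.cnRowSumMatrix_eq, h.cnMatrix_eq]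
  ext u v
  by_cases huv : u = v
  · subst huv
    simp only [cliqueBlockMatrix, cliqueRowSum, ite_self, Matrix.sub_apply, Matrix.add_apply,
      Matrix.diagonal_apply_eq, Function.comp_apply, Matrix.of_apply, if_true]
    ring
  · by_cases hf : f u = f v <;> simp [cliqueBlockMatrix, huv, hf]

theorem cnSignlessLaplacian_eq (h : IsCliqueUnion Γ s f) :
    Γ.cnSignlessLaplacian =
      cliqueBlockMatrix f (fun i => (s i - 2) ^ 2 : ι → ℝ) (fun i => s i - 2) := by
  rw [cnSignlessLaplacian, h.cnRowSumMatrix_eq, h.cnMatrix_eq]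
  ext u v
  by_cases huv : u = v
  · subst huv
    simp only [cliqueBlockMatrix, cliqueRowSum, ite_self, Matrix.add_apply,
      Matrix.diagonal_apply_eq, Function.comp_apply, Matrix.of_apply, if_true]
    ring
  · simp [cliqueBlockMatrix, huv]

section FintypeIndex

variable [Fintype ι]

theorem sum_comp (h : IsCliqueUnion Γ s f) (g : ι → ℝ) : ∑ v, g (f v) = ∑ i, s i * g i := by
  classical
  rw [← Finset.sum_fiberwise Finset.univ f]
  refine Finset.sum_congr rfl fun i _ => ?_
  rw [Finset.sum_congr rfl fun v hv => congrArg g (Finset.mem_filter.1 hv).2, Finset.sum_const,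
    nsmul_eq_mul, ← h.ncard_fiber, Set.ncard_eq_toFinset_card']
  congr 3
  ext v
  simp

theorem sum_mul_cnDelta (h : IsCliqueUnion Γ s f) :
    (∑ i, (s i : ℝ)) * Γ.cnDelta = ∑ i, s i * cliqueRowSum (s i) := by
  have card : (Fintype.card V : ℝ) = ∑ i, (s i : ℝ) := by simpa using h.sum_comp fun _ => 1
  have trace : Γ.cnRowSumMatrix.trace = ∑ i, s i * cliqueRowSum (s i) := by
    rw [← h.sum_comp fun i => cliqueRowSum (s i)]
    simp [h.cnRowSumMatrix_eq, cliqueBlockMatrix, Matrix.trace]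
  rw [← card, cnDelta, mul_div_cancel_of_imp', trace]
  intro card_eq_zero
  have : IsEmpty V := by simpa [Fintype.card_eq_zero_iff] using card_eq_zero
  simp [Matrix.trace]

theorem cnEnergy_eq (h : IsCliqueUnion Γ s f) :
    Γ.cnEnergy = ∑ i, ((s i - 1) * |(s i : ℝ) - 2| + |cliqueRowSum (s i)| : ℝ) := by
  rw [cnEnergy, h.cnMatrix_eq, sum_map_eigenvalueMultiset_cliqueBlockMatrix]
  refine Finset.sum_congr rfl fun i _ => ?_
  rw [h.ncard_fiber, abs_sub_comm (s i : ℝ), cliqueRowSum]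
  ring_nf

theorem cnLaplacianEnergy_eq (h : IsCliqueUnion Γ s f) :
    Γ.cnLaplacianEnergy =
      ∑ i, ((s i - 1) * |s i * (s i - 2) - Γ.cnDelta| + |Γ.cnDelta| : ℝ) := by
  rw [cnLaplacianEnergy, h.cnLaplacian_eq, sum_map_eigenvalueMultiset_cliqueBlockMatrix]
  refine Finset.sum_congr rfl fun i _ => ?_
  have root_eq_zero : (s i * (s i - 2) + s i * (2 - s i) : ℝ) = 0 := by ring
  rw [h.ncard_fiber, root_eq_zero, zero_sub, abs_neg]

theorem cnSignlessLaplacianEnergy_eq (h : IsCliqueUnion Γ s f) :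
    Γ.cnSignlessLaplacianEnergy =
      ∑ i, ((s i - 1) * |(s i - 2) ^ 2 - Γ.cnDelta| +
        |2 * cliqueRowSum (s i) - Γ.cnDelta| : ℝ) := by
  rw [cnSignlessLaplacianEnergy, h.cnSignlessLaplacian_eq,
    sum_map_eigenvalueMultiset_cliqueBlockMatrix]
  refine Finset.sum_congr rfl fun i _ => ?_
  rw [h.ncard_fiber, cliqueRowSum]
  ring_nf

end FintypeIndex

variable [Finite ι]

theorem cnDelta_eq_of_forall_cliqueRowSum_eq [Nonempty V] (h : IsCliqueUnion Γ s f) {d : ℝ}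
    (hd : ∀ i, cliqueRowSum (s i) = d) : Γ.cnDelta = d := by
  have := Fintype.ofFinite ι
  have card : (∑ i, (s i : ℝ)) = Fintype.card V := by simpa using (h.sum_comp fun _ => 1).symm
  have average := h.sum_mul_cnDelta
  simp only [hd, ← Finset.sum_mul, card] at average
  exact mul_left_cancel₀ (by simp) average

theorem energies_eq_of_forall_cliqueRowSum_eq (h : IsCliqueUnion Γ s f) {d : ℝ}
    (hd : ∀ i, cliqueRowSum (s i) = d) :
    Γ.cnEnergy = Γ.cnLaplacianEnergy ∧ Γ.cnLaplacianEnergy = Γ.cnSignlessLaplacianEnergy := by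
  have := Fintype.ofFinite ι
  rcases isEmpty_or_nonempty V with _ | _
  · simp [cnEnergy, cnLaplacianEnergy, cnSignlessLaplacianEnergy, eigenvalueMultiset]
  have laplacian_root (x : ℝ) : x * (x - 2) - (x - 1) * (x - 2) = x - 2 := by ring
  have signless_root (x : ℝ) : (x - 2) ^ 2 - (x - 1) * (x - 2) = -(x - 2) := by ring
  rw [h.cnEnergy_eq, h.cnLaplacianEnergy_eq, h.cnSignlessLaplacianEnergy_eq,
    h.cnDelta_eq_of_forall_cliqueRowSum_eq hd]
  constructor <;> refine Finset.sum_congr rfl fun i _ => ?_ <;> rw [← hd i, cliqueRowSum]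
  · rw [laplacian_root]
  · rw [laplacian_root, signless_root, abs_neg, two_mul, add_sub_cancel_right]

end IsCliqueUnion

section CliqueInequalities

variable {s : ℕ} {D : ℝ}

theorem sub_one_mul_abs_sub_two (hs : 1 ≤ s) : (s - 1) * |(s : ℝ) - 2| = cliqueRowSum s := by
  rw [cliqueRowSum]
  obtain rfl | two_le := hs.eq_or_lt
  · norm_num
  · have two_le : (2 : ℝ) ≤ s := by exact_mod_cast two_le
    rw [abs_of_nonneg (sub_nonneg.2 two_le)]

theorem laplacian_term_of_two_mul_cliqueRowSum_le (hD : 2 * cliqueRowSum s ≤ D) :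
    (s - 1) * |s * (s - 2) - D| + |D| = s * (D - cliqueRowSum s) := by
  have D_nonneg : 0 ≤ D := by linarith [cliqueRowSum_nonneg s]
  have root_le : (s * (s - 2) : ℝ) ≤ D := by
    rw [cliqueRowSum] at hD
    obtain lt_two | two_le := lt_or_ge s 2
    · interval_cases s <;> norm_num <;> linarith
    · have two_le : (2 : ℝ) ≤ s := by exact_mod_cast two_le
      nlinarith
  rw [abs_of_nonpos (sub_nonpos.2 root_le), abs_of_nonneg D_nonneg, cliqueRowSum]
  ring

theorem signless_term_of_two_mul_cliqueRowSum_le (hD : 2 * cliqueRowSum s ≤ D) :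
    (s - 1) * |((s : ℝ) - 2) ^ 2 - D| + |2 * cliqueRowSum s - D| = s * (D - cliqueRowSum s) := by
  rw [abs_of_nonpos (sub_nonpos.2 hD)]
  rw [cliqueRowSum] at hD ⊢
  obtain lt_two | two_le := lt_or_ge s 2
  · interval_cases s
    · norm_num at hD ⊢
      rw [abs_of_nonpos (sub_nonpos.2 hD)]
      ring
    · norm_num
  · have two_le : (2 : ℝ) ≤ s := by exact_mod_cast two_le
    have root_le : ((s : ℝ) - 2) ^ 2 ≤ D := by nlinarith
    rw [abs_of_nonpos (sub_nonpos.2 root_le)]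
    ring

theorem two_lt_of_pos_of_lt_cliqueRowSum (hs : 1 ≤ s) (hD : 0 < D) (h : D < cliqueRowSum s) :
    2 < s := by
  by_contra! hle
  interval_cases s <;> norm_num [cliqueRowSum] at h <;> linarith

theorem laplacian_term_of_lt_cliqueRowSum (hs : 2 < s) (hD : 0 < D) (h : D < cliqueRowSum s) :
    (s - 1) * |s * (s - 2) - D| + |D| = s * (cliqueRowSum s - D) + 2 * D := by
  have hs : (2 : ℝ) < s := by exact_mod_cast hs
  have le_root : D ≤ s * (s - 2) := by
    rw [cliqueRowSum] at h
    nlinarith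
  rw [abs_of_nonneg (sub_nonneg.2 le_root), abs_of_pos hD, cliqueRowSum]
  ring

theorem le_signless_term_of_lt_cliqueRowSum (hs : 1 ≤ s) (h : D < cliqueRowSum s) :
    4 * cliqueRowSum s - 2 * D ≤
      (s - 1) * |((s : ℝ) - 2) ^ 2 - D| + |2 * cliqueRowSum s - D| +
        s * (cliqueRowSum s - D) := by
  have hs : (1 : ℝ) ≤ s := by exact_mod_cast hs
  have abs_bound : (s - 1) * (D - (s - 2) ^ 2) ≤ (s - 1) * |((s : ℝ) - 2) ^ 2 - D| := by
    rw [abs_sub_comm]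
    exact mul_le_mul_of_nonneg_left (le_abs_self _) (sub_nonneg.2 hs)
  rw [abs_of_nonneg (by linarith [cliqueRowSum_nonneg s] : 0 ≤ 2 * cliqueRowSum s - D)]
  rw [cliqueRowSum] at *
  linarith

theorem signless_term_lt_of_lt_cliqueRowSum (hs : 2 < s) (hD : 0 < D) (h : D < cliqueRowSum s) :
    (s - 1) * |((s : ℝ) - 2) ^ 2 - D| + |2 * cliqueRowSum s - D| <
      s * (cliqueRowSum s - D) + 2 * D := by
  have hs : (2 : ℝ) < s := by exact_mod_cast hs
  rw [abs_of_nonneg (by linarith : 0 ≤ 2 * cliqueRowSum s - D)]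
  rw [cliqueRowSum] at *
  rcases abs_cases (((s : ℝ) - 2) ^ 2 - D) with ⟨habs, -⟩ | ⟨habs, -⟩ <;> rw [habs] <;> nlinarith

theorem add_add_one_mul_cliqueRowSum_lt {m b k : ℕ} (hm : 2 ≤ m) (hb : 1 ≤ b) (hmb : 2 < m * b)
    (hk : m + k + 1 ≤ m ^ 2) : (m + k + 1) * cliqueRowSum b < cliqueRowSum (m * b) := by
  have hk : (m + k + 1 : ℝ) ≤ m ^ 2 := by exact_mod_cast hk
  have gap : cliqueRowSum (m * b) - m ^ 2 * cliqueRowSum b =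
      (m - 1) * (3 * (m * b) - 2 * m - 2) := by
    rw [cliqueRowSum, cliqueRowSum]
    push_cast
    ring
  have gap_factor_pos : (0 : ℝ) < 3 * (m * b) - 2 * m - 2 := by
    have : 2 * m + 2 < 3 * (m * b) := by nlinarith
    have : (2 * m + 2 : ℝ) < 3 * (m * b) := by exact_mod_cast this
    linarith
  have m_sub_one_pos : (0 : ℝ) < m - 1 := by
    have : (2 : ℝ) ≤ m := by exact_mod_cast hm
    linarith
  calc (m + k + 1) * cliqueRowSum b ≤ m ^ 2 * cliqueRowSum b :=
        mul_le_mul_of_nonneg_right hk (cliqueRowSum_nonneg b)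
    _ < cliqueRowSum (m * b) := by
        linarith [mul_pos m_sub_one_pos gap_factor_pos]

theorem weighted_mean_bounds {m k A B : ℝ} (hm : 1 ≤ m) (hk : 0 < k) (hB : 0 ≤ B)
    (hAB : (m + k + 1) * B < A) (hD : (m + k) * D = m * A + k * B) :
    2 * B ≤ D ∧ k * B < A - D := by
  have weight_pos : 0 < m + k := by linarith
  have excess : 0 ≤ (m - 1) * (m + k) * B := by
    have := sub_nonneg.2 hm
    positivity
  constructor
  · refine le_of_mul_le_mul_left ?_ weight_pos
    linarith [mul_lt_mul_of_pos_left hAB (by linarith : 0 < m)]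
  · refine lt_of_mul_lt_mul_left ?_ weight_pos.le
    linarith [mul_lt_mul_of_pos_left hAB hk]

end CliqueInequalities

namespace IsCliqueUnion

variable {V ι : Type*} [Fintype V] {Γ : SimpleGraph V} {s : ι → ℕ} {f : V → ι}

theorem cnEnergy_eq_sum_two_mul [Fintype ι] (h : IsCliqueUnion Γ s f) (hs : ∀ i, 1 ≤ s i) :
    Γ.cnEnergy = ∑ i, 2 * cliqueRowSum (s i) := by
  rw [h.cnEnergy_eq]
  refine Finset.sum_congr rfl fun i _ => ?_
  rw [sub_one_mul_abs_sub_two (hs i), abs_of_nonneg (cliqueRowSum_nonneg _), two_mul]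

section DominantClique

variable {i₀ : ι}

theorem sum_erase_mul_cnDelta_sub [Fintype ι] [DecidableEq ι] (h : IsCliqueUnion Γ s f) (i₀ : ι) :
    ∑ i ∈ Finset.univ.erase i₀, s i * (Γ.cnDelta - cliqueRowSum (s i)) =
      s i₀ * (cliqueRowSum (s i₀) - Γ.cnDelta) := by
  have total : ∑ i, s i * (Γ.cnDelta - cliqueRowSum (s i)) = 0 := by
    simp only [mul_sub, Finset.sum_sub_distrib, ← Finset.sum_mul, h.sum_mul_cnDelta, sub_self]
  rw [← Finset.add_sum_erase _ _ (Finset.mem_univ i₀)] at total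
  linarith

theorem cnDelta_pos_of_lt_cliqueRowSum [Finite ι] (h : IsCliqueUnion Γ s f) (hs : 1 ≤ s i₀)
    (hi₀ : Γ.cnDelta < cliqueRowSum (s i₀)) : 0 < Γ.cnDelta := by
  classical
  have := Fintype.ofFinite ι
  by_contra! hle
  have rest_nonpos := Finset.sum_nonpos fun i (_ : i ∈ Finset.univ.erase i₀) =>
    mul_nonpos_of_nonneg_of_nonpos (Nat.cast_nonneg (α := ℝ) (s i))
      (sub_nonpos.2 (hle.trans (cliqueRowSum_nonneg (s i))))
  rw [h.sum_erase_mul_cnDelta_sub] at rest_nonpos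
  have s_pos : (0 : ℝ) < s i₀ := by exact_mod_cast hs
  exact rest_nonpos.not_gt (mul_pos s_pos (sub_pos.2 hi₀))

theorem cnLaplacianEnergy_eq_of_small_cliques [Finite ι] (h : IsCliqueUnion Γ s f)
    (hsmall : ∀ i ≠ i₀, 2 * cliqueRowSum (s i) ≤ Γ.cnDelta) :
    Γ.cnLaplacianEnergy =
      (s i₀ - 1) * |s i₀ * (s i₀ - 2) - Γ.cnDelta| + |Γ.cnDelta| +
        s i₀ * (cliqueRowSum (s i₀) - Γ.cnDelta) := by
  classical
  have := Fintype.ofFinite ι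
  rw [h.cnLaplacianEnergy_eq, ← Finset.add_sum_erase _ _ (Finset.mem_univ i₀),
    ← h.sum_erase_mul_cnDelta_sub]
  exact congrArg _ <| Finset.sum_congr rfl fun i hi =>
    laplacian_term_of_two_mul_cliqueRowSum_le (hsmall i (Finset.ne_of_mem_erase hi))

theorem cnSignlessLaplacianEnergy_eq_of_small_cliques [Finite ι] (h : IsCliqueUnion Γ s f)
    (hsmall : ∀ i ≠ i₀, 2 * cliqueRowSum (s i) ≤ Γ.cnDelta) :
    Γ.cnSignlessLaplacianEnergy =
      (s i₀ - 1) * |((s i₀ : ℝ) - 2) ^ 2 - Γ.cnDelta| + |2 * cliqueRowSum (s i₀) - Γ.cnDelta| +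
        s i₀ * (cliqueRowSum (s i₀) - Γ.cnDelta) := by
  classical
  have := Fintype.ofFinite ι
  rw [h.cnSignlessLaplacianEnergy_eq, ← Finset.add_sum_erase _ _ (Finset.mem_univ i₀),
    ← h.sum_erase_mul_cnDelta_sub]
  exact congrArg _ <| Finset.sum_congr rfl fun i hi =>
    signless_term_of_two_mul_cliqueRowSum_le (hsmall i (Finset.ne_of_mem_erase hi))

theorem energies_lt_of_dominant_clique [Fintype ι] [DecidableEq ι] (h : IsCliqueUnion Γ s f)
    (hs : ∀ i, 1 ≤ s i) (hsmall : ∀ i ≠ i₀, 2 * cliqueRowSum (s i) ≤ Γ.cnDelta)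
    (hi₀ : ∑ i ∈ Finset.univ.erase i₀, cliqueRowSum (s i) < cliqueRowSum (s i₀) - Γ.cnDelta) :
    Γ.cnEnergy < Γ.cnSignlessLaplacianEnergy ∧
      Γ.cnSignlessLaplacianEnergy < Γ.cnLaplacianEnergy := by
  have lt_rowSum : Γ.cnDelta < cliqueRowSum (s i₀) := by
    linarith [Finset.sum_nonneg fun i (_ : i ∈ Finset.univ.erase i₀) => cliqueRowSum_nonneg (s i)]
  have cnDelta_pos := h.cnDelta_pos_of_lt_cliqueRowSum (hs i₀) lt_rowSum
  have two_lt := two_lt_of_pos_of_lt_cliqueRowSum (hs i₀) cnDelta_pos lt_rowSum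
  rw [h.cnLaplacianEnergy_eq_of_small_cliques hsmall,
    h.cnSignlessLaplacianEnergy_eq_of_small_cliques hsmall,
    laplacian_term_of_lt_cliqueRowSum two_lt cnDelta_pos lt_rowSum]
  constructor
  · rw [h.cnEnergy_eq_sum_two_mul hs, ← Finset.mul_sum,
      ← Finset.add_sum_erase _ _ (Finset.mem_univ i₀)]
    linarith [le_signless_term_of_lt_cliqueRowSum (hs i₀) lt_rowSum]
  · linarith [signless_term_lt_of_lt_cliqueRowSum two_lt cnDelta_pos lt_rowSum]

end DominantClique

theorem energies_lt_of_proportional_clique {κ : Type*} [Fintype κ] [Nonempty κ]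
    {m b : ℕ} {f : V → Option κ} (h : IsCliqueUnion Γ (fun i => i.elim (m * b) fun _ => b) f)
    (hb : 1 ≤ b) (hm : m + Fintype.card κ + 1 ≤ m ^ 2) (hmb : 2 < m * b) :
    Γ.cnEnergy < Γ.cnSignlessLaplacianEnergy ∧
      Γ.cnSignlessLaplacianEnergy < Γ.cnLaplacianEnergy := by
  classical
  set k := Fintype.card κ with hk
  have hk1 : 1 ≤ k := Fintype.card_pos
  have hm2 : 2 ≤ m := by
    by_contra! hlt
    interval_cases m <;> omega
  have rowSum_lt : (m + k + 1) * cliqueRowSum b < cliqueRowSum (m * b) :=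
    add_add_one_mul_cliqueRowSum_lt hm2 hb hmb hm
  have average : (m + k) * Γ.cnDelta = m * cliqueRowSum (m * b) + k * cliqueRowSum b := by
    have average := h.sum_mul_cnDelta
    simp only [Fintype.sum_option, Option.elim_none, Option.elim_some, Finset.sum_const,
      Finset.card_univ, nsmul_eq_mul, Nat.cast_mul, ← hk] at average
    refine mul_left_cancel₀ (by positivity : (b : ℝ) ≠ 0) ?_
    linear_combination average
  obtain ⟨hsmall, hbig⟩ := weighted_mean_bounds (by exact_mod_cast one_le_two.trans hm2)
    (by exact_mod_cast hk1) (cliqueRowSum_nonneg b) rowSum_lt average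
  refine h.energies_lt_of_dominant_clique (i₀ := none) ?_ ?_ ?_
  · rintro (_ | _)
    exacts [two_pos.trans hmb, hb]
  · rintro (_ | _) hi
    exacts [absurd rfl hi, hsmall]
  · have erase_none : Finset.univ.erase (none : Option κ) = Finset.univ.map .some := by
      ext (_ | _) <;> simp
    simpa [erase_none, ← hk] using hbig

end IsCliqueUnion

theorem ncard_preimage_of_ncard_fiber {α β : Type*} [Finite α] [Finite β] (f : α → β) {T : Set β}
    {k : ℕ} (hk : ∀ t ∈ T, (f ⁻¹' {t}).ncard = k) : (f ⁻¹' T).ncard = T.ncard * k := by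
  have fiber_card : ∀ t ∈ T.toFinite.toFinset, Nat.card {a // f a = t} = k := fun t ht =>
    hk t (T.toFinite.mem_toFinset.1 ht)
  have sum_fibers := Finset.card_preimage_eq_sum_card_image_eq (f := f)
    (s := T.toFinite.toFinset) fun _ _ => Set.toFinite _
  rw [Finset.sum_congr rfl fiber_card, Finset.sum_const, smul_eq_mul,
    ← Set.ncard_eq_toFinset_card, Set.Finite.coe_toFinset] at sum_fibers
  exact sum_fibers

theorem ncard_carrier_mk {G : Type*} [Group G] (x : G) :
    (ConjClasses.mk x).carrier.ncard = (Subgroup.centralizer {x}).index := by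
  rw [← ConjAct.orbit_eq_carrier_conjClasses, ← MulAction.index_stabilizer,
    Subgroup.centralizer_eq_comap_stabilizer]
  exact (Subgroup.index_comap_of_surjective _ ConjAct.toConjAct.surjective).symm

section CentralExtension

variable {G H : Type*} [Group G] [Group H] {φ : G →* H}

theorem commute_of_map_mem_zpowers (hker : φ.ker ≤ Subgroup.center G) {h : H} {x y : G}
    (hx : φ x ∈ Subgroup.zpowers h) (hy : φ y ∈ Subgroup.zpowers h) : Commute x y := by
  have ker_le : (φ.subgroupComap (Subgroup.zpowers h)).ker ≤ Subgroup.center _ := by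
    intro a ha
    refine Subgroup.mem_center_iff.2 fun b => Subtype.ext ?_
    exact Subgroup.mem_center_iff.1 (hker (congrArg Subtype.val ha)) b
  have comm := (φ.subgroupComap (Subgroup.zpowers h)).isMulCommutative_of_isCyclic_of_ker_le_center
    ker_le
  exact congrArg Subtype.val (comm.is_comm.comm ⟨x, hx⟩ ⟨y, hy⟩)

theorem ncard_preimage_of_ker_eq_center [Finite G] (hφ : Function.Surjective φ)
    (hker : φ.ker = Subgroup.center G) (T : Set H) :
    (φ ⁻¹' T).ncard = T.ncard * Nat.card (Subgroup.center G) := by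
  have : Finite H := Finite.of_surjective φ hφ
  refine ncard_preimage_of_ncard_fiber φ fun t _ => ?_
  rw [← Nat.card_coe_set_eq, ← hker]
  exact Nat.card_congr (φ.fiberEquivKerOfSurjective hφ t)

end CentralExtension

section Dihedral

open DihedralGroup Subgroup

variable {n : ℕ}

theorem r_mem_zpowers_r_one (i : ZMod n) : r i ∈ zpowers (r 1 : DihedralGroup n) := by
  obtain ⟨k, rfl⟩ := ZMod.intCast_surjective i
  exact ⟨k, r_one_zpow k⟩

theorem index_zpowers_r_one [NeZero n] : (zpowers (r 1 : DihedralGroup n)).index = 2 := by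
  have lagrange := (zpowers (r 1 : DihedralGroup n)).index_mul_card
  rw [Nat.card_zpowers, orderOf_r_one, DihedralGroup.nat_card] at lagrange
  exact Nat.eq_of_mul_eq_mul_right (NeZero.pos n) lagrange

theorem index_zpowers_sr (i : ZMod n) : (zpowers (sr i)).index = n := by
  have lagrange := (zpowers (sr i)).index_mul_card
  rw [Nat.card_zpowers, orderOf_sr, DihedralGroup.nat_card, mul_comm 2 n] at lagrange
  exact Nat.eq_of_mul_eq_mul_right two_pos lagrange

theorem mem_zmultiples_two_iff {i : ZMod n} :
    i ∈ AddSubgroup.zmultiples (2 : ZMod n) ↔ ∃ c, i = 2 * c := by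
  rw [AddSubgroup.mem_zmultiples_iff]
  constructor
  · rintro ⟨k, rfl⟩
    exact ⟨k, by rw [zsmul_eq_mul, mul_comm]⟩
  · rintro ⟨c, rfl⟩
    obtain ⟨k, rfl⟩ := ZMod.intCast_surjective c
    exact ⟨k, by rw [zsmul_eq_mul, mul_comm]⟩

/-- The index set `ℤ/n / 2(ℤ/n)` of the conjugacy classes of reflections of the dihedral group of
order `2 n`: it has one element if `n` is odd and two if `n` is even. -/
abbrev ReflectionClass (n : ℕ) : Type := ZMod n ⧸ AddSubgroup.zmultiples (2 : ZMod n)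

theorem isConj_sr_iff {i j : ZMod n} :
    IsConj (sr i) (sr j) ↔ (i : ReflectionClass n) = j := by
  rw [QuotientAddGroup.eq, mem_zmultiples_two_iff, isConj_iff]
  constructor
  · rintro ⟨c | c, h⟩
    · simp only [r_mul_sr, inv_r, sr_mul_r, sr.injEq] at h
      exact ⟨-c, by rw [← h]; ring⟩
    · simp only [sr_mul_sr, inv_sr, r_mul_sr, sr.injEq] at h
      exact ⟨c - i, by rw [← h]; ring⟩
  · rintro ⟨c, h⟩
    refine ⟨r (-c), ?_⟩
    rw [r_mul_sr, inv_r, sr_mul_r, eq_add_of_neg_add_eq h]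
    ring_nf

theorem card_reflectionClass [NeZero n] : Nat.card (ReflectionClass n) = n.gcd 2 := by
  have lagrange := AddSubgroup.card_eq_card_quotient_mul_card_addSubgroup
    (AddSubgroup.zmultiples (2 : ZMod n))
  have order : addOrderOf (2 : ZMod n) = n / n.gcd 2 := by
    exact_mod_cast ZMod.addOrderOf_coe 2 (NeZero.ne n)
  rw [Nat.card_zmod, Nat.card_zmultiples, order] at lagrange
  refine Nat.eq_of_mul_eq_mul_right (Nat.div_gcd_pos_of_pos_left 2 (NeZero.pos n)) ?_
  rw [← lagrange, Nat.mul_div_cancel' (n.gcd_dvd_left 2)]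

/-- The type of an element of a dihedral group: `none` for a rotation, and the conjugacy class for a
reflection. -/
def reflectionType : DihedralGroup n → Option (ReflectionClass n)
  | r _ => none
  | sr i => some i

theorem reflectionType_eq_of_isConj {g h : DihedralGroup n} (hgh : IsConj g h) :
    reflectionType g = reflectionType h := by
  rcases g with i | i <;> rcases h with j | j
  · rfl
  · obtain ⟨c | c, hc⟩ := isConj_iff.1 hgh <;> simp at hc
  · obtain ⟨c | c, hc⟩ := isConj_iff.1 hgh <;> simp at hc
  · exact congrArg some (isConj_sr_iff.1 hgh)

theorem ncard_ne_one_reflectionType_none [NeZero n] :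
    {g : DihedralGroup n | g ≠ 1 ∧ reflectionType g = none}.ncard = n - 1 := by
  have eq_range_sdiff : {g : DihedralGroup n | g ≠ 1 ∧ reflectionType g = none} =
      Set.range r \ {r 0} := by
    ext (i | i) <;> simp [reflectionType]
  rw [eq_range_sdiff, Set.ncard_sdiff_singleton_of_mem (Set.mem_range_self (0 : ZMod n)),
    ← Nat.card_coe_set_eq, Nat.card_range_of_injective fun _ _ h => r.inj h, Nat.card_zmod]

theorem gcd_mul_ncard_reflectionType_some [NeZero n] (q : ReflectionClass n) :
    n.gcd 2 * {g : DihedralGroup n | g ≠ 1 ∧ reflectionType g = some q}.ncard = n := by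
  have eq_image : {g : DihedralGroup n | g ≠ 1 ∧ reflectionType g = some q} =
      sr '' ((↑) ⁻¹' {q} : Set (ZMod n)) := by
    ext (i | i) <;> simp [reflectionType, one_def, -r_zero]
  have coset_card : ((↑) ⁻¹' {q} : Set (ZMod n)).ncard =
      Nat.card (AddSubgroup.zmultiples (2 : ZMod n)) := by
    rw [← Nat.card_coe_set_eq, Nat.card_congr
      (QuotientAddGroup.preimageMkEquivAddSubgroupProdSet _ _), Nat.card_prod,
      Nat.card_coe_set_eq {q}, Set.ncard_singleton, mul_one]
  rw [eq_image, Set.ncard_image_of_injective _ fun _ _ h => sr.inj h, coset_card,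
    ← card_reflectionClass, ← AddSubgroup.card_eq_card_quotient_mul_card_addSubgroup, Nat.card_zmod]

end Dihedral

section DihedralQuotient

open DihedralGroup Subgroup

variable {G : Type*} [Group G] {n : ℕ} {φ : G →* DihedralGroup n}

theorem mem_center_of_commute (hker : φ.ker ≤ center G) {x y : G} {i j : ZMod n} (hx : φ x = r i)
    (hy : φ y = sr j) (h : Commute x y) : x ∈ center G := by
  have commute_rotation {g : G} {k : ZMod n} (hg : φ g = r k) : Commute x g :=
    commute_of_map_mem_zpowers hker (hx ▸ r_mem_zpowers_r_one i) (hg ▸ r_mem_zpowers_r_one k)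
  refine mem_center_iff.2 fun g => ?_
  rcases hg : φ g with k | k
  · exact (commute_rotation hg).symm
  · have commute_mul : Commute x (y * g) :=
      commute_rotation (by rw [map_mul, hy, hg, sr_mul_sr] : φ (y * g) = r (k - j))
    simpa using (h.inv_right.mul_right commute_mul).symm.eq

theorem map_eq_of_commute (hker : φ.ker = center G) {x y : G} {i j : ZMod n} (hx : φ x = sr i)
    (hy : φ y = sr j) (h : Commute x y) : φ x = φ y := by
  have map_inv_mul : φ (x⁻¹ * y) = r (j - i) := by rw [map_mul, map_inv, hx, hy, inv_sr, sr_mul_sr]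
  have mem_ker := mem_center_of_commute hker.le map_inv_mul hx
    ((Commute.refl x).inv_left.mul_left h.symm)
  rw [← hker, MonoidHom.mem_ker, map_mul, map_inv] at mem_ker
  exact inv_mul_eq_one.1 mem_ker

theorem centralizer_of_map_eq_r (hker : φ.ker ≤ center G) {x : G} {i : ZMod n} (hx : φ x = r i)
    (hxc : x ∉ center G) : centralizer {x} = (zpowers (r 1)).comap φ := by
  ext y
  rw [mem_centralizer_singleton_iff, mem_comap]
  constructor
  · intro h
    rcases hy : φ y with j | j
    · exact r_mem_zpowers_r_one j
    · exact absurd (mem_center_of_commute hker hx hy h.symm) hxc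
  · exact fun hy => commute_of_map_mem_zpowers hker hy (hx ▸ r_mem_zpowers_r_one i)

theorem centralizer_of_map_eq_sr (hker : φ.ker = center G) {x : G} {i : ZMod n}
    (hx : φ x = sr i) : centralizer {x} = (zpowers (sr i)).comap φ := by
  ext y
  rw [mem_centralizer_singleton_iff, mem_comap]
  constructor
  · intro h
    rcases hy : φ y with j | j
    · have mem_ker : y ∈ φ.ker := hker ▸ mem_center_of_commute hker.le hy hx h
      rw [← hy, mem_ker]
      exact one_mem _
    · rw [← hy, map_eq_of_commute hker hy hx h, hx]
      exact mem_zpowers _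
  · exact fun hy => commute_of_map_mem_zpowers hker.le hy (hx ▸ mem_zpowers _)

theorem ncard_carrier_mk_of_notMem_center [NeZero n] (hφ : Function.Surjective φ)
    (hker : φ.ker = center G) {x : G} (hx : x ∉ center G) :
    (ConjClasses.mk x).carrier.ncard = (reflectionType (φ x)).elim 2 fun _ => n := by
  rw [ncard_carrier_mk]
  rcases hx' : φ x with i | i
  · rw [centralizer_of_map_eq_r hker.le hx' hx, index_comap_of_surjective _ hφ]
    exact index_zpowers_r_one
  · rw [centralizer_of_map_eq_sr hker hx', index_comap_of_surjective _ hφ]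
    exact index_zpowers_sr i

theorem reflectionType_map_eq_of_commute (hker : φ.ker = center G) {x y : G} (hx : x ∉ center G)
    (hy : y ∉ center G) (h : Commute x y) : reflectionType (φ x) = reflectionType (φ y) := by
  rcases hx' : φ x with i | i <;> rcases hy' : φ y with j | j
  · rfl
  · exact absurd (mem_center_of_commute hker.le hx' hy' h) hx
  · exact absurd (mem_center_of_commute hker.le hy' hx' h.symm) hy
  · rw [← hx', ← hy', map_eq_of_commute hker hx' hy' h]

theorem exists_isConj_commute_of_reflectionType_map_eq (hφ : Function.Surjective φ)
    (hker : φ.ker ≤ center G) {x y : G} (h : reflectionType (φ x) = reflectionType (φ y)) :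
    ∃ x', IsConj x x' ∧ Commute x' y := by
  rcases hx : φ x with i | i <;> rcases hy : φ y with j | j <;> rw [hx, hy] at h
  · exact ⟨x, .refl x, commute_of_map_mem_zpowers hker (hx ▸ r_mem_zpowers_r_one i)
      (hy ▸ r_mem_zpowers_r_one j)⟩
  · cases h
  · cases h
  · obtain ⟨c, hc⟩ := isConj_iff.1 (isConj_sr_iff.2 (Option.some_injective _ h))
    obtain ⟨g, rfl⟩ := hφ c
    have map_conj : φ (g * x * g⁻¹) = φ y := by rw [map_mul, map_mul, map_inv, hx, hc, hy]
    exact ⟨g * x * g⁻¹, isConj_iff.2 ⟨g, rfl⟩, commute_of_map_mem_zpowers hker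
      (map_conj ▸ mem_zpowers _) (mem_zpowers _)⟩

theorem CCCVertex.notMem_center (c : CCCVertex G) {x : G} (hx : ConjClasses.mk x = c.1) :
    x ∉ center G := by
  obtain ⟨y, hy, hyc⟩ := c.2
  have hxy : IsConj x y := ConjClasses.mk_eq_mk_iff_isConj.1 (hx.trans hyc.symm)
  exact fun hxc => hy (hxy.eq_of_left_mem_center hxc ▸ hxc)

/-- The type of a noncentral conjugacy class of a group with dihedral quotient `φ`: the
`reflectionType` of the image of any of its elements. -/
def vertexType (φ : G →* DihedralGroup n) (c : CCCVertex G) : Option (ReflectionClass n) :=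
  Quotient.lift (fun x => reflectionType (φ x))
    (fun _ _ h => reflectionType_eq_of_isConj (φ.map_isConj h)) c.1

theorem vertexType_eq (φ : G →* DihedralGroup n) {c : CCCVertex G} {x : G}
    (hx : ConjClasses.mk x = c.1) : vertexType φ c = reflectionType (φ x) := by
  rw [vertexType, ← hx]
  rfl

theorem cccGraph_adj_iff_vertexType_eq (hφ : Function.Surjective φ) (hker : φ.ker = center G)
    (u v : CCCVertex G) : (cccGraph G).Adj u v ↔ u ≠ v ∧ vertexType φ u = vertexType φ v := by
  refine and_congr_right fun _ => ⟨?_, fun h => ?_⟩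
  · rintro ⟨x, hx, y, hy, hxy⟩
    rw [ConjClasses.mem_carrier_iff_mk_eq] at hx hy
    rw [vertexType_eq φ hx, vertexType_eq φ hy]
    exact reflectionType_map_eq_of_commute hker (u.notMem_center hx) (v.notMem_center hy) hxy
  · obtain ⟨x, -, hx⟩ := u.2
    obtain ⟨y, -, hy⟩ := v.2
    rw [vertexType_eq φ hx, vertexType_eq φ hy] at h
    obtain ⟨x', hxx', hcomm⟩ := exists_isConj_commute_of_reflectionType_map_eq hφ hker.le h
    exact ⟨x', ConjClasses.mem_carrier_iff_mk_eq.2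
      ((ConjClasses.mk_eq_mk_iff_isConj.2 hxx'.symm).trans hx), y,
      ConjClasses.mem_carrier_iff_mk_eq.2 hy, hcomm⟩

theorem ncard_vertexType_fiber_mul [Finite G] [NeZero n] (hφ : Function.Surjective φ)
    (hker : φ.ker = center G) (i : Option (ReflectionClass n)) :
    (vertexType φ ⁻¹' {i}).ncard * (i.elim 2 fun _ => n) =
      {g : DihedralGroup n | g ≠ 1 ∧ reflectionType g = i}.ncard * Nat.card (center G) := by
  have preimage_mk_eq : ConjClasses.mk ⁻¹' (Subtype.val '' (vertexType φ ⁻¹' {i})) =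
      φ ⁻¹' {g | g ≠ 1 ∧ reflectionType g = i} := by
    ext x
    change (∃ c : CCCVertex G, vertexType φ c = i ∧ c.1 = ConjClasses.mk x) ↔
      ¬ x ∈ φ.ker ∧ reflectionType (φ x) = i
    rw [hker]
    constructor
    · rintro ⟨c, rfl, hc⟩
      exact ⟨c.notMem_center hc.symm, (vertexType_eq φ hc.symm).symm⟩
    · rintro ⟨hx, rfl⟩
      exact ⟨⟨ConjClasses.mk x, x, hx, rfl⟩, rfl, rfl⟩
  have class_size : ∀ t ∈ Subtype.val '' (vertexType φ ⁻¹' {i}),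
      (ConjClasses.mk ⁻¹' {t}).ncard = i.elim 2 fun _ => n := by
    rintro _ ⟨c, rfl, rfl⟩
    obtain ⟨x, hx, hxc⟩ := c.2
    rw [vertexType_eq φ hxc, ← ncard_carrier_mk_of_notMem_center hφ hker hx, hxc,
      ConjClasses.carrier_eq_preimage_mk]
  rw [← ncard_preimage_of_ker_eq_center hφ hker, ← preimage_mk_eq,
    ncard_preimage_of_ncard_fiber _ class_size,
    Set.ncard_image_of_injective _ Subtype.val_injective]

theorem exists_isCliqueUnion_cccGraph [Finite G] [NeZero n] (hφ : Function.Surjective φ)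
    (hker : φ.ker = center G) : ∃ m b, 2 * m = n.gcd 2 * (n - 1) ∧
      n.gcd 2 * b = Nat.card (center G) ∧
      IsCliqueUnion (cccGraph G) (fun i : Option (ReflectionClass n) => i.elim (m * b) fun _ => b)
        (vertexType φ) := by
  have card_some (q : ReflectionClass n) :
      n.gcd 2 * (vertexType φ ⁻¹' {some q}).ncard = Nat.card (center G) := by
    refine Nat.eq_of_mul_eq_mul_right (NeZero.pos n) ?_
    calc _ = n.gcd 2 * ((vertexType φ ⁻¹' {some q}).ncard * n) := mul_assoc _ _ _
      _ = n.gcd 2 * {g : DihedralGroup n | g ≠ 1 ∧ reflectionType g = some q}.ncard *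
          Nat.card (center G) := by
        rw [mul_assoc]
        exact congrArg _ (ncard_vertexType_fiber_mul hφ hker (some q))
      _ = _ := by rw [gcd_mul_ncard_reflectionType_some, mul_comm]
  have card_none : (vertexType φ ⁻¹' {none}).ncard * 2 = (n - 1) * Nat.card (center G) := by
    rw [← ncard_ne_one_reflectionType_none]
    exact ncard_vertexType_fiber_mul hφ hker none
  have two_dvd : 2 ∣ n.gcd 2 * (n - 1) := by
    rcases Nat.even_or_odd n with hn | hn
    · exact (Nat.dvd_gcd hn.two_dvd dvd_rfl).mul_right _
    · exact (hn.tsub_odd odd_one).two_dvd.mul_left _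
  obtain ⟨m, hm⟩ := two_dvd
  refine ⟨m, (vertexType φ ⁻¹' {some 0}).ncard, hm.symm, card_some 0,
    cccGraph_adj_iff_vertexType_eq hφ hker, ?_⟩
  rintro (_ | q)
  · refine Nat.eq_of_mul_eq_mul_right two_pos ?_
    change _ = m * _ * 2
    rw [card_none, ← card_some 0]
    linear_combination (vertexType φ ⁻¹' {some 0}).ncard * hm
  · exact Nat.eq_of_mul_eq_mul_left (Nat.gcd_pos_of_pos_right n two_pos)
      ((card_some q).trans (card_some 0).symm)

end DihedralQuotient

theorem clique_size_bounds {n z m b : ℕ} (hn : 4 ≤ n) (hm : 2 * m = n.gcd 2 * (n - 1))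
    (hb : n.gcd 2 * b = z) (hz : 0 < z) (hnz : ¬ (n = 5 ∧ z = 1)) :
    1 ≤ b ∧ m + n.gcd 2 + 1 ≤ m ^ 2 ∧ 2 < m * b := by
  have b_pos : 1 ≤ b := Nat.pos_of_mul_pos_left (hb ▸ hz)
  rcases (Nat.dvd_prime Nat.prime_two).1 (n.gcd_dvd_right 2) with gcd_eq | gcd_eq <;>
    rw [gcd_eq] at hm hb ⊢
  · have hm2 : 2 ≤ m := by omega
    refine ⟨b_pos, by nlinarith, ?_⟩
    obtain hm3 | hb2 : 3 ≤ m ∨ 2 ≤ b := by omega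
    all_goals nlinarith
  · have hm3 : 3 ≤ m := by omega
    exact ⟨b_pos, by nlinarith, by nlinarith⟩

theorem mainTheorem5 (G : Type*) [Group G] [Finite G] (n z : ℕ) (hn : 3 ≤ n)
    (hz : Nat.card (Subgroup.center G) = z)
    (hG : Nonempty (G ⧸ Subgroup.center G ≃* DihedralGroup n)) :
    (((n = 3 ∧ 1 ≤ z) ∨ (n = 5 ∧ z = 1)) →
      (cccGraph G).cnEnergy = (cccGraph G).cnLaplacianEnergy ∧
      (cccGraph G).cnLaplacianEnergy = (cccGraph G).cnSignlessLaplacianEnergy) ∧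
    (¬ ((n = 3 ∧ 1 ≤ z) ∨ (n = 5 ∧ z = 1)) →
      (cccGraph G).cnEnergy < (cccGraph G).cnSignlessLaplacianEnergy ∧
      (cccGraph G).cnSignlessLaplacianEnergy < (cccGraph G).cnLaplacianEnergy) := by
  obtain ⟨e⟩ := hG
  have : NeZero n := ⟨by omega⟩
  obtain ⟨m, b, hm, hb, cliques⟩ := exists_isCliqueUnion_cccGraph
    (φ := e.toMonoidHom.comp (QuotientGroup.mk' (Subgroup.center G)))
    (e.surjective.comp (QuotientGroup.mk'_surjective _))
    ((MonoidHom.ker_mulEquiv_comp _ e).trans (QuotientGroup.ker_mk' _))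
  have z_pos : 0 < Nat.card (Subgroup.center G) := Nat.card_pos
  constructor
  · rintro (⟨rfl, -⟩ | ⟨rfl, rfl⟩) <;>
      refine cliques.energies_eq_of_forall_cliqueRowSum_eq (d := cliqueRowSum b) ?_
    · obtain rfl : m = 1 := by norm_num at hm; omega
      rintro (_ | _) <;> simp
    · obtain ⟨rfl, rfl⟩ : m = 2 ∧ b = 1 := by norm_num at hm hb; omega
      rintro (_ | _) <;> simp [cliqueRowSum]
  · intro generic
    obtain ⟨b_pos, hm', hmb⟩ := clique_size_bounds (by omega) hm hb z_pos (by omega)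
    have := Fintype.ofFinite (ReflectionClass n)
    refine cliques.energies_lt_of_proportional_clique b_pos ?_ hmb
    rwa [← Nat.card_eq_fintype_card, card_reflectionClass]
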